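/- Let $c_u,c_o>0$ be the underage and overage costs and $q=c_u/(c_u+c_o)$. For an order quantity $a\in[0,1]$ and a probability distribution $F$ on $[0,1]$ let $c(a,F)=\mathbb E_{D\sim F}[c_o(a-D)^++c_u(D-a)^+]$ and $R(a,F)=c(a,F)-\min_{a'\in[0,1]}c(a',F)$. Let $0=x_0\le x_1\le\dots\le x_K\le x_{K+1}=1$ be given, where $x_1,\dots,x_K$ are the historical inventory levels, let $n_1,\dots,n_K\in\mathbb N$ be the numbers of samples observed at these levels, with $n=\sum_{k=1}^K n_k\ge 1$, and put $\sigma_k=\sum_{\ell=1}^k n_\ell$. From independent demands $D^{(k)}_i\sim F$ ($1\le k\le K$, $1\le i\le n_k$) only censored information is observed, including the sales $S^{(k)}_i=\min\{D^{(k)}_i,x_k\}$. The Biased SAA policy $\pi^{\mathrm{BSAA}}$ orders $\inf\{u\in[0,1]:\hat F(u)\ge q\}$, where $\hat F$ is the empirical distribution function of all $n$ sales. Its worst-case regret is $\mathsf{Reg}(\pi^{\mathrm{BSAA}}\mid\boldsymbol x)=\sup_F\mathbb E[R(\pi^{\mathrm{BSAA}},F)]$, the supremum being over all probability distributions $F$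 on $[0,1]$ and the expectation over the historical demands. For integers $m\ge 0$ and $r\le m$ let $B_{r,m}(p)=\sum_{j=r}^m\binom mj p^j(1-p)^{m-j}$ if $r\ge 0$ and $B_{r,m}(p)=1$ if $r<0$, and for $0\le k\le K$ and $v\in[0,1]$ let $$\Psi_k(v)=\bigl(1-B_{\lceil qn\rceil-\sigma_k,\;n-\sigma_k}(v)\bigr)(v-q)+(q-v)^+ .$$ Then $$\mathsf{Reg}(\pi^{\mathrm{BSAA}}\mid\boldsymbol x)=(c_u+c_o)\,\max_{-1\le i\le K}\ \sup_{\substack{v\in[0,q]\\ w\in[q,1]}}\left\{\sum_{k=0}^{i}(x_{k+1}-x_k)\Psi_k(v)+\sum_{k=i+1}^{K}(x_{k+1}-x_k)\Psi_k(w)\right\},$$ where for $i=-1$ the first sum is empty and for $i=K$ the second one is. Moreover, the supremum over $F$ is attained at a distribution of the form $\alpha\delta_0+\beta\delta_{x_j}+(1-\alpha-\beta)\delta_1$ with $j\in\{1,\dots,K\}$, $\alpha,\beta\ge 0$ and $\alpha+\beta\le 1$. -/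

import Mathlib

open MeasureTheory

namespace Newsvendor

noncomputable section

/-- Newsvendor cost `c(a, d) = c_o (a - d)⁺ + c_u (d - a)⁺` of order quantity `a` at demand `d`. -/
def cost (cu co a d : ℝ) : ℝ := co * max (a - d) 0 + cu * max (d - a) 0

/-- Expected cost `c(a, F)` of order quantity `a` under the demand distribution `F`. -/
def expectedCost (cu co a : ℝ) (F : Measure ℝ) : ℝ := ∫ d, cost cu co a d ∂F

/-- Optimal cost `opt(F)`: the least expected cost over order quantities in `[0,1]`. -/
def optCost (cu co : ℝ) (F : Measure ℝ) : ℝ :=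
  ⨅ a : Set.Icc (0 : ℝ) 1, expectedCost cu co a F

/-- Regret `R(a, F) = c(a, F) - opt(F)`. -/
def regret (cu co a : ℝ) (F : Measure ℝ) : ℝ := expectedCost cu co a F - optCost cu co F

/-- `Δ([0,1])`: the probability distributions supported on `[0,1]`. -/
def demandLaws : Set (Measure ℝ) := {F | IsProbabilityMeasure F ∧ F (Set.Icc (0 : ℝ) 1)ᶜ = 0}

/-- Labels `(k, i)` of the historical samples: `n k` samples at the `k`-th inventory level. -/
abbrev Sample {K : ℕ} (n : Fin K → ℕ) : Type := (k : Fin K) × Fin (n k)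

/-- Historical information: for each sample the sales and the indicator `δ`. -/
abbrev Info {K : ℕ} (n : Fin K → ℕ) : Type := Sample n → ℝ × Bool

/-- Data-driven policies: maps from historical inventories and information to an order. -/
abbrev Policy {K : ℕ} (n : Fin K → ℕ) : Type := (Fin K → ℝ) → Info n → ℝ

/-- The censored information `(min {D, x_k}, 1(D ≤ x_k))` produced by the demands `D`. -/
def censor {K : ℕ} {n : Fin K → ℕ} (x : Fin K → ℝ) (D : Sample n → ℝ) : Info n :=
  fun s => (min (D s) (x s.1), decide (D s ≤ x s.1))

/-- Expected regret of the policy `π` when all demands are independent draws from `F`. -/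
def expectedRegret {K : ℕ} {n : Fin K → ℕ} (cu co : ℝ) (π : Policy n) (x : Fin K → ℝ)
    (F : Measure ℝ) : ℝ :=
  ∫ D, regret cu co (π x (censor x D)) F ∂(Measure.pi fun _ : Sample n => F)

/-- Worst-case regret: supremum of the expected regret over all demand distributions. -/
def worstCaseRegret {K : ℕ} {n : Fin K → ℕ} (cu co : ℝ) (π : Policy n) (x : Fin K → ℝ) : ℝ :=
  sSup ((fun F => expectedRegret cu co π x F) '' demandLaws)

/-- Empirical distribution function of the pooled sales. -/
def salesCDF {K : ℕ} {n : Fin K → ℕ} (I : Info n) (u : ℝ) : ℝ :=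
  ((Finset.univ.filter fun s : Sample n => (I s).1 ≤ u).card : ℝ) / ((∑ k, n k : ℕ) : ℝ)

/-- Biased sample average approximation with critical fractile `q`: the empirical `q`-quantile of
the pooled sales, treated as if they were demands. -/
def bsaa {K : ℕ} (n : Fin K → ℕ) (q : ℝ) : Policy n :=
  fun _ I => sInf {u : ℝ | u ∈ Set.Icc (0 : ℝ) 1 ∧ q ≤ salesCDF I u}

/-- The order prescribed by `bsaa` lies in `[0,1]`. -/
theorem bsaa_mem_Icc {K : ℕ} (n : Fin K → ℕ) (q : ℝ) (x : Fin K → ℝ) (I : Info n) :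
    bsaa n q x I ∈ Set.Icc (0 : ℝ) 1 := by
  unfold bsaa
  rcases Set.eq_empty_or_nonempty {u : ℝ | u ∈ Set.Icc (0 : ℝ) 1 ∧ q ≤ salesCDF I u} with h | h
  · rw [h]; simp
  · obtain ⟨u, hu⟩ := h
    exact ⟨Real.sInf_nonneg fun y hy => hy.1.1,
      (csInf_le ⟨0, fun y hy => hy.1.1⟩ hu).trans hu.1.2⟩

/-- The binomial tail polynomial `B_{r,m}(p) = ∑_{j=r}^m C(m,j) p^j (1-p)^{m-j}`, with value `1`
if `r < 0`. -/
def bernsteinTail (r : ℤ) (m : ℕ) (p : ℝ) : ℝ :=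
  if r < 0 then 1
  else ∑ j ∈ Finset.Icc r.toNat m, (m.choose j : ℝ) * p ^ j * (1 - p) ^ (m - j)

/-- Breakpoints `x_0 = 0, x_1, …, x_K, x_{K+1} = 1` (the entry `x j` of `x : Fin K → ℝ` is the
`(j+1)`-st historical inventory level). -/
def breakpoint {K : ℕ} (x : Fin K → ℝ) : Fin (K + 2) → ℝ :=
  Fin.cons (α := fun _ => ℝ) 0 (Fin.snoc (α := fun _ => ℝ) x 1)

/-- Cumulative sample count `σ_k`: the number of samples at the `k` smallest inventory levels. -/
def cumCount {K : ℕ} (n : Fin K → ℕ) (k : Fin (K + 1)) : ℕ :=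
  ∑ l ∈ Finset.univ.filter (fun l : Fin K => (l : ℕ) < k), n l

/-- `Ψ_k(v) = (1 - B_{⌈q N⌉ - σ_k, N - σ_k}(v)) (v - q) + (q - v)⁺`, where `N` is the total number
of samples. -/
def psi {K : ℕ} (n : Fin K → ℕ) (q : ℝ) (k : Fin (K + 1)) (v : ℝ) : ℝ :=
  (1 - bernsteinTail (⌈q * ((∑ l, n l : ℕ) : ℝ)⌉ - (cumCount n k : ℤ))
      ((∑ l, n l) - cumCount n k) v) * (v - q) + max (q - v) 0

/-- The two-scalar objective with crossing index `i ∈ {-1, 0, …, K}`: `v` is used on the intervals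
`[x_k, x_{k+1})` with `k ≤ i` and `w` on those with `k > i`. -/
def objective {K : ℕ} (n : Fin K → ℕ) (q : ℝ) (x : Fin K → ℝ) (i : ℤ) (v w : ℝ) : ℝ :=
  (∑ k ∈ Finset.univ.filter (fun k : Fin (K + 1) => ((k : ℕ) : ℤ) ≤ i),
      (breakpoint x k.succ - breakpoint x k.castSucc) * psi n q k v) +
  ∑ k ∈ Finset.univ.filter (fun k : Fin (K + 1) => i < ((k : ℕ) : ℤ)),
      (breakpoint x k.succ - breakpoint x k.castSucc) * psi n q k w

/-- The distribution `α δ_0 + β δ_y + (1 - α - β) δ_1`. -/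
def threePoint (α β y : ℝ) : Measure ℝ :=
  ENNReal.ofReal α • Measure.dirac 0 + ENNReal.ofReal β • Measure.dirac y +
    ENNReal.ofReal (1 - α - β) • Measure.dirac 1

end

end Newsvendor

namespace Newsvendor

/-! Writing `(a - d)⁺` as the integral of the indicator of `d ≤ u < a` turns the regret of an order
`a` into an integral over `u` of a quantity depending only on `F(u)` and on whether `u < a`
(`regret_eq`). For `u` between `x_k` and `x_{k+1}`, the `σ_k` sales at levels at most `u` are surely
at most `u`, and the others are at most `u` exactly when their demands are. So `P(order ≤ u)` is a
binomial tail in `F(u)` (`measureReal_bsaa_le`), and by Fubini the expected regret is `cu + co`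
times the sum over `k` of the integral of `Ψ_k(F(u))` (`expectedRegret_eq`).

It remains to maximise over nondecreasing `F`. Maximising `Ψ_k` over the range allowed by the
endpoint values of `F` leaves one value per interval, still nondecreasing in `k`
(`exists_monotone_sum_integral_le`). On either side of `q`, passing to a larger `k` preserves any
preference for the smaller of two values (`psi_single_crossing`), because ratios of consecutive
binomial tails are monotone. A preference that can only move towards small values while the values
themselves increase makes pooling optimal (`exists_sum_le_sum_const`): one value `v` below `q` and
one value `w` above it suffice.

Conversely, every triple `(i, v, w)` is realised by a three-point law with its middle atom at an
inventory level (`exists_threePoint_expectedRegret_eq`). Compactness supplies an optimal triple,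
hence both the formula and its attainment. -/

/-! ### Binomial tails and their ratio inequalities. -/

/-- The binomial probability of `j` successes in `m` trials. -/
noncomputable def binomMass (m j : ℕ) (p : ℝ) : ℝ := (m.choose j : ℝ) * p ^ j * (1 - p) ^ (m - j)

theorem binomMass_nonneg (m j : ℕ) {p : ℝ} (hp : p ∈ Set.Icc (0 : ℝ) 1) : 0 ≤ binomMass m j p := by
  have h0 := hp.1
  have h1 : 0 ≤ 1 - p := by linarith [hp.2]
  unfold binomMass; positivity

theorem binomMass_succ (m j : ℕ) (p : ℝ) :
    binomMass (m + 1) (j + 1) p = p * binomMass m j p + (1 - p) * binomMass m (j + 1) p := by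
  unfold binomMass
  rw [Nat.choose_succ_succ, Nat.add_sub_add_right]
  rcases lt_or_ge j m with h | h
  · obtain ⟨d, rfl⟩ := Nat.exists_eq_add_of_lt h
    rw [show j + d + 1 - j = d + 1 by omega, show j + d + 1 - (j + 1) = d by omega]
    push_cast; ring
  · rw [Nat.choose_eq_zero_of_lt (show m < j + 1 by omega)]
    push_cast; ring

theorem bernsteinTail_natCast (s m : ℕ) (p : ℝ) :
    bernsteinTail s m p = ∑ j ∈ Finset.Icc s m, binomMass m j p := by
  simp [bernsteinTail, binomMass]

theorem bernsteinTail_of_nonpos {r : ℤ} (hr : r ≤ 0) (m : ℕ) (p : ℝ) :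
    bernsteinTail r m p = 1 := by
  rcases hr.lt_or_eq with h | rfl
  · simp [bernsteinTail, h]
  · have h := add_pow p (1 - p) m
    rw [add_sub_cancel, one_pow] at h
    rw [h, bernsteinTail, if_neg (lt_irrefl 0), Finset.range_eq_Ico, Int.toNat_zero]
    refine Finset.sum_congr (by ext; simp) fun j _ => by ring

theorem bernsteinTail_eq_add (s m : ℕ) (p : ℝ) :
    bernsteinTail s m p = binomMass m s p + bernsteinTail ((s + 1 : ℕ) : ℤ) m p := by
  rw [bernsteinTail_natCast, bernsteinTail_natCast]
  rcases le_or_gt s m with h | h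
  · rw [← Finset.insert_Icc_add_one_left_eq_Icc h, Finset.sum_insert (by simp)]
  · rw [Finset.Icc_eq_empty (by omega), Finset.Icc_eq_empty (by omega)]
    simp [binomMass, Nat.choose_eq_zero_of_lt h]

theorem one_sub_bernsteinTail (s m : ℕ) (p : ℝ) :
    1 - bernsteinTail s m p = ∑ j ∈ Finset.range s, binomMass m j p := by
  induction s with
  | zero => simp [bernsteinTail_of_nonpos]
  | succ s ih => rw [Finset.sum_range_succ, ← ih, bernsteinTail_eq_add s]; ring

/-- Condition on the last trial: `s + 1` successes in `m + 1` trials require at least `s` in the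
first `m`, and fail then only if there were exactly `s` and the last trial is a failure. -/
theorem bernsteinTail_succ_succ (s m : ℕ) (p : ℝ) :
    bernsteinTail ((s + 1 : ℕ) : ℤ) (m + 1) p
      = bernsteinTail s m p - (1 - p) * binomMass m s p := by
  induction s with
  | zero =>
    have h := bernsteinTail_eq_add 0 (m + 1) p
    rw [Nat.cast_zero, bernsteinTail_of_nonpos le_rfl] at h
    rw [Nat.cast_zero, bernsteinTail_of_nonpos le_rfl]
    simp only [binomMass, Nat.choose_zero_right, pow_zero, Nat.sub_zero, zero_add] at h ⊢
    rw [pow_succ] at h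
    push_cast at h ⊢
    linarith
  | succ s ih =>
    have h1 := bernsteinTail_eq_add (s + 1) (m + 1) p
    have h2 := bernsteinTail_eq_add s m p
    have h3 := binomMass_succ m s p
    linarith

theorem continuous_bernsteinTail (r : ℤ) (m : ℕ) : Continuous (bernsteinTail r m) := by
  unfold bernsteinTail
  split_ifs <;> fun_prop

theorem bernsteinTail_pos {s m : ℕ} (h : s ≤ m) {p : ℝ} (hp : 0 < p) (hp1 : p ≤ 1) :
    0 < bernsteinTail s m p := by
  rw [bernsteinTail_natCast]
  refine Finset.sum_pos' (fun j _ => binomMass_nonneg m j ⟨hp.le, hp1⟩)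
    ⟨m, by simp [h], ?_⟩
  simp only [binomMass, Nat.choose_self, Nat.sub_self, pow_zero]
  positivity

theorem one_sub_bernsteinTail_pos (s m : ℕ) {p : ℝ} (hp : 0 ≤ p) (hp1 : p < 1) :
    0 < 1 - bernsteinTail ((s + 1 : ℕ) : ℤ) m p := by
  rw [one_sub_bernsteinTail]
  refine Finset.sum_pos' (fun j _ => binomMass_nonneg m j ⟨hp, hp1.le⟩)
    ⟨0, by simp, ?_⟩
  have : 0 < 1 - p := by linarith
  simp only [binomMass, Nat.choose_zero_right, Nat.sub_zero, pow_zero]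
  positivity

theorem bernsteinTail_nonneg (s m : ℕ) {p : ℝ} (hp : p ∈ Set.Icc (0 : ℝ) 1) :
    0 ≤ bernsteinTail s m p := by
  rw [bernsteinTail_natCast]
  exact Finset.sum_nonneg fun j _ => binomMass_nonneg m j hp

theorem bernsteinTail_le_one (s m : ℕ) {p : ℝ} (hp : p ∈ Set.Icc (0 : ℝ) 1) :
    0 ≤ 1 - bernsteinTail s m p := by
  rw [one_sub_bernsteinTail]
  exact Finset.sum_nonneg fun j _ => binomMass_nonneg m j hp

/-- Monotone likelihood ratio with an extra factor `1 - p`: after cancelling common factors only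
`key` remains, where `d = j - s`. -/
theorem binomMass_cross_of_le {m s j : ℕ} (h : s ≤ j) (hj : j ≤ m) {u v : ℝ} (hu : 0 ≤ u)
    (huv : u ≤ v) (hv : v ≤ 1) :
    binomMass m j u * ((1 - v) * binomMass m s v) ≤
      binomMass m j v * ((1 - u) * binomMass m s u) := by
  obtain ⟨d, rfl⟩ := Nat.exists_eq_add_of_le h
  obtain ⟨e, rfl⟩ := Nat.exists_eq_add_of_le hj
  have hv0 : 0 ≤ v := hu.trans huv
  have hv1 : 0 ≤ 1 - v := by linarith
  have hu1 : 0 ≤ 1 - u := by linarith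
  have key : u ^ d * (1 - v) ^ (d + 1) ≤ v ^ d * (1 - u) ^ (d + 1) :=
    mul_le_mul (pow_le_pow_left₀ hu huv d) (pow_le_pow_left₀ hv1 (by linarith) _)
      (by positivity) (by positivity)
  unfold binomMass
  rw [show s + d + e - (s + d) = e by omega, show s + d + e - s = d + e by omega]
  have hc : 0 ≤ ((s + d + e).choose (s + d) : ℝ) * ((s + d + e).choose s : ℝ) * (u * v) ^ s *
      ((1 - u) * (1 - v)) ^ e := by positivity
  have := mul_le_mul_of_nonneg_left key hc
  simp only [mul_pow] at this
  calc _ = _ := by ring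
    _ ≤ _ := this
    _ = _ := by ring

theorem binomMass_cross_of_lt {m s j : ℕ} (h : j < s) (hs : s ≤ m) {u v : ℝ} (hu : 0 ≤ u)
    (huv : u ≤ v) (hv : v ≤ 1) :
    binomMass m j v * ((1 - u) * binomMass m s u) ≤
      binomMass m j u * ((1 - v) * binomMass m s v) := by
  obtain ⟨d, rfl⟩ := Nat.exists_eq_add_of_lt h
  obtain ⟨e, rfl⟩ := Nat.exists_eq_add_of_le hs
  have hv0 : 0 ≤ v := hu.trans huv
  have hv1 : 0 ≤ 1 - v := by linarith
  have hu1 : 0 ≤ 1 - u := by linarith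
  have key : u ^ (d + 1) * (1 - v) ^ d ≤ v ^ (d + 1) * (1 - u) ^ d :=
    mul_le_mul (pow_le_pow_left₀ hu huv _) (pow_le_pow_left₀ hv1 (by linarith) _)
      (by positivity) (by positivity)
  unfold binomMass
  rw [show j + d + 1 + e - (j + d + 1) = e by omega,
    show j + d + 1 + e - j = d + 1 + e by omega]
  have hc : 0 ≤ ((j + d + 1 + e).choose (j + d + 1) : ℝ) * ((j + d + 1 + e).choose j : ℝ) *
      (u * v) ^ j * ((1 - u) * (1 - v)) ^ (e + 1) := by positivity
  have := mul_le_mul_of_nonneg_left key hc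
  simp only [mul_pow] at this
  calc _ = _ := by ring
    _ ≤ _ := this
    _ = _ := by ring

/-- The ratio of `B_{s,m}` to `B_{s+1,m+1}` is nonincreasing, in a division-free form. Substituting
`bernsteinTail_succ_succ` cancels the product of the two tails and leaves a termwise comparison of
masses. -/
theorem bernsteinTail_cross {s m : ℕ} {u v : ℝ} (hu : 0 ≤ u) (huv : u ≤ v)
    (hv : v ≤ 1) :
    bernsteinTail s m v * bernsteinTail ((s + 1 : ℕ) : ℤ) (m + 1) u ≤
      bernsteinTail s m u * bernsteinTail ((s + 1 : ℕ) : ℤ) (m + 1) v := by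
  have key : bernsteinTail s m u * ((1 - v) * binomMass m s v) ≤
      bernsteinTail s m v * ((1 - u) * binomMass m s u) := by
    rw [bernsteinTail_natCast, bernsteinTail_natCast, Finset.sum_mul, Finset.sum_mul]
    refine Finset.sum_le_sum fun j hj => ?_
    rw [Finset.mem_Icc] at hj
    exact binomMass_cross_of_le hj.1 hj.2 hu huv hv
  rw [bernsteinTail_succ_succ, bernsteinTail_succ_succ]
  linarith

theorem one_sub_bernsteinTail_cross {s m : ℕ} (hs : s ≤ m) {u v : ℝ} (hu : 0 ≤ u) (huv : u ≤ v)
    (hv : v ≤ 1) :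
    (1 - bernsteinTail s m v) * (1 - bernsteinTail ((s + 1 : ℕ) : ℤ) (m + 1) u) ≤
      (1 - bernsteinTail s m u) * (1 - bernsteinTail ((s + 1 : ℕ) : ℤ) (m + 1) v) := by
  have key : (1 - bernsteinTail s m v) * ((1 - u) * binomMass m s u) ≤
      (1 - bernsteinTail s m u) * ((1 - v) * binomMass m s v) := by
    rw [one_sub_bernsteinTail, one_sub_bernsteinTail, Finset.sum_mul, Finset.sum_mul]
    refine Finset.sum_le_sum fun j hj => ?_
    exact binomMass_cross_of_lt (Finset.mem_range.1 hj) hs hu huv hv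
  rw [bernsteinTail_succ_succ, bernsteinTail_succ_succ]
  linarith

/-! ### Single crossing of the regret densities. -/

/-- The regret density of a quantile rule that needs `r` of `m` samples below the current point,
where the demand distribution function equals `v`. -/
noncomputable def regretDensity (q : ℝ) (r : ℤ) (m : ℕ) (v : ℝ) : ℝ :=
  (1 - bernsteinTail r m v) * (v - q) + max (q - v) 0

theorem regretDensity_of_le {q v : ℝ} (h : v ≤ q) (r : ℤ) (m : ℕ) :
    regretDensity q r m v = bernsteinTail r m v * (q - v) := by
  rw [regretDensity, max_eq_left (by linarith)]; ring

theorem regretDensity_of_ge {q v : ℝ} (h : q ≤ v) (r : ℤ) (m : ℕ) :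
    regretDensity q r m v = (1 - bernsteinTail r m v) * (v - q) := by
  rw [regretDensity, max_eq_right (by linarith)]; ring

theorem regretDensity_of_nonpos {q v : ℝ} {r : ℤ} (h : r ≤ 0) (m : ℕ) :
    regretDensity q r m v = max (q - v) 0 := by
  rw [regretDensity, bernsteinTail_of_nonpos h]; ring

/-- One censored sample lowers both `r` and `m` by one. Below `q` the density is a tail times `q -
v`, so the cross inequality transfers the comparison after division by the tail at `u`. -/
theorem regretDensity_step_of_le {q : ℝ} (hq : q ≤ 1) {r : ℤ} {m : ℕ} (hr : r ≤ m) {u v : ℝ}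
    (hu : 0 ≤ u) (huv : u ≤ v) (hv : v ≤ q)
    (h : regretDensity q (r + 1) (m + 1) v ≤ regretDensity q (r + 1) (m + 1) u) :
    regretDensity q r m v ≤ regretDensity q r m u := by
  rcases huv.eq_or_lt with rfl | huv'
  · exact le_rfl
  rcases lt_or_ge r 0 with hr0 | hr0
  · rw [regretDensity_of_nonpos (by omega), regretDensity_of_nonpos (by omega)] at *
    exact h
  lift r to ℕ using hr0
  have hv1 := hv.trans hq
  have hv0 := hu.trans huv
  rw [regretDensity_of_le hv, regretDensity_of_le (huv.trans hv)] at *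
  have hx := bernsteinTail_cross (s := r) (m := m) hu huv hv1
  push_cast at hx
  have hn : 0 ≤ bernsteinTail (r : ℤ) m u := bernsteinTail_nonneg r m ⟨hu, huv.trans hv1⟩
  have hpv : 0 < bernsteinTail ((r : ℤ) + 1) (m + 1) v := by
    exact_mod_cast bernsteinTail_pos (s := r + 1) (m := m + 1) (by omega) (hu.trans_lt huv') hv1
  have h1 := mul_le_mul_of_nonneg_right hx (show 0 ≤ q - v by linarith)
  have h2 := mul_le_mul_of_nonneg_left h hn
  -- At `u = 0` the tail to divide by vanishes; the hypothesis then forces `v = q`, where the left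
  -- side is zero.
  rcases hu.eq_or_lt with rfl | hu'
  · have h0 : bernsteinTail ((r : ℤ) + 1) (m + 1) 0 = 0 := by
      have := bernsteinTail_natCast (r + 1) (m + 1) 0
      push_cast at this
      rw [this]
      refine Finset.sum_eq_zero fun j hj => ?_
      rw [Finset.mem_Icc] at hj
      simp [binomMass, show j ≠ 0 by omega]
    rw [h0, zero_mul] at h
    have hqv : q - v = 0 := by nlinarith
    rw [hqv, mul_zero]
    exact mul_nonneg hn (by linarith)
  · have hpu : 0 < bernsteinTail ((r : ℤ) + 1) (m + 1) u := by
      exact_mod_cast bernsteinTail_pos (s := r + 1) (m := m + 1) (by omega) hu' (huv.trans hv1)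
    refine le_of_mul_le_mul_right ?_ hpu
    linarith

theorem regretDensity_step_of_ge {q : ℝ} (hq : 0 ≤ q) {r : ℤ} {m : ℕ} (hr : r ≤ m) {u v : ℝ}
    (hu : q ≤ u) (huv : u ≤ v) (hv : v ≤ 1)
    (h : regretDensity q (r + 1) (m + 1) v ≤ regretDensity q (r + 1) (m + 1) u) :
    regretDensity q r m v ≤ regretDensity q r m u := by
  rcases huv.eq_or_lt with rfl | huv'
  · exact le_rfl
  rcases lt_or_ge r 0 with hr0 | hr0
  · rw [regretDensity_of_nonpos (by omega), regretDensity_of_nonpos (by omega)] at *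
    exact h
  lift r to ℕ using hr0
  rw [regretDensity_of_ge hu, regretDensity_of_ge (hu.trans huv)] at *
  have hx := one_sub_bernsteinTail_cross (s := r) (m := m) (by omega) (hq.trans hu) huv hv
  push_cast at hx
  have hn : 0 ≤ 1 - bernsteinTail (r : ℤ) m u :=
    bernsteinTail_le_one r m ⟨hq.trans hu, huv.trans hv⟩
  have hpu : 0 < 1 - bernsteinTail ((r : ℤ) + 1) (m + 1) u := by
    exact_mod_cast one_sub_bernsteinTail_pos r (m + 1) (hq.trans hu) (huv'.trans_le hv)
  have h1 := mul_le_mul_of_nonneg_right hx (show 0 ≤ v - q by linarith)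
  have h2 := mul_le_mul_of_nonneg_left h hn
  refine le_of_mul_le_mul_right ?_ hpu
  linarith

theorem continuous_psi {K : ℕ} (n : Fin K → ℕ) (q : ℝ) (k : Fin (K + 1)) :
    Continuous (psi n q k) := by
  unfold psi
  have := continuous_bernsteinTail (⌈q * ((∑ l, n l : ℕ) : ℝ)⌉ - (cumCount n k : ℤ))
      ((∑ l, n l) - cumCount n k)
  fun_prop

theorem cumCount_mono {K : ℕ} (n : Fin K → ℕ) : Monotone (cumCount n) := fun a b hab =>
  Finset.sum_le_sum_of_subset fun l hl => by
    simp only [Finset.mem_filter, Finset.mem_univ, true_and] at hl ⊢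
    exact hl.trans_le hab

theorem cumCount_le {K : ℕ} (n : Fin K → ℕ) (k : Fin (K + 1)) : cumCount n k ≤ ∑ l, n l :=
  Finset.sum_le_sum_of_subset (Finset.filter_subset _ _)

theorem ceil_mul_le {q : ℝ} (hq : q ≤ 1) (N : ℕ) : ⌈q * (N : ℝ)⌉ ≤ (N : ℤ) := by
  rw [Int.ceil_le]
  push_cast
  exact mul_le_of_le_one_left N.cast_nonneg hq

/-- Single crossing: a preference for the smaller of two values `u ≤ v` on the same side of `q`
is inherited by larger indices. -/
theorem psi_single_crossing {K : ℕ} (n : Fin K → ℕ) {q : ℝ} (hq0 : 0 ≤ q) (hq : q ≤ 1)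
    {k l : Fin (K + 1)} (hkl : k ≤ l) {u v : ℝ} (hu : 0 ≤ u) (huv : u ≤ v) (hv : v ≤ 1)
    (hside : v ≤ q ∨ q ≤ u) (h : psi n q k v ≤ psi n q k u) : psi n q l v ≤ psi n q l u := by
  -- Move from `σ_k` to `σ_l` one sample at a time; intermediate counts `t` need not be of the form
  -- `σ_j`.
  have key : ∀ t, cumCount n k ≤ t → t ≤ ∑ l, n l →
      regretDensity q (⌈q * ((∑ l, n l : ℕ) : ℝ)⌉ - (t : ℤ)) ((∑ l, n l) - t) v ≤
      regretDensity q (⌈q * ((∑ l, n l : ℕ) : ℝ)⌉ - (t : ℤ)) ((∑ l, n l) - t) u := by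
    intro t ht
    induction t, ht using Nat.le_induction with
    | base => exact fun _ => h
    | succ t ht ih =>
      intro ht'
      have hc := ceil_mul_le hq (∑ l, n l)
      have ih := ih (by omega)
      have e1 : ⌈q * ((∑ l, n l : ℕ) : ℝ)⌉ - (t : ℤ)
          = (⌈q * ((∑ l, n l : ℕ) : ℝ)⌉ - ((t + 1 : ℕ) : ℤ)) + 1 := by push_cast; ring
      have e2 : (∑ l, n l) - t = (∑ l, n l) - (t + 1) + 1 := by omega
      rw [e1, e2] at ih
      rcases hside with hs | hs
      · exact regretDensity_step_of_le hq (by omega) hu huv hs ih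
      · exact regretDensity_step_of_ge hq0 (by omega) hs huv hv ih
  exact key _ (cumCount_mono n hkl) (cumCount_le n l)

/-! ### Counting independent draws that fall in a set. -/

open scoped Classical in
theorem measureReal_pi_pattern {ι : Type*} [Fintype ι] (F : Measure ℝ) [IsProbabilityMeasure F]
    {A : Set ℝ} (hA : MeasurableSet A) {T S : Finset ι} (hS : S ⊆ T) :
    (Measure.pi fun _ : ι => F).real {D | T.filter (fun i => D i ∈ A) = S} =
      F.real A ^ S.card * (1 - F.real A) ^ (T.card - S.card) := by
  have hset : {D : ι → ℝ | T.filter (fun i => D i ∈ A) = S} =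
      Set.univ.pi fun i => if i ∈ S then A else if i ∈ T then Aᶜ else Set.univ := by
    ext D
    simp only [Set.mem_ofPred_eq, Set.mem_univ_pi, Finset.ext_iff, Finset.mem_filter]
    refine forall_congr' fun i => ?_
    by_cases h1 : i ∈ S
    · simp [h1, hS h1]
    · by_cases h2 : i ∈ T <;> simp [h1, h2]
  rw [hset, measureReal_def, Measure.pi_pi, ENNReal.toReal_prod]
  have hterm : ∀ i, (F (if i ∈ S then A else if i ∈ T then Aᶜ else Set.univ)).toReal =
      (if i ∈ S then F.real A else 1) * (if i ∈ T \ S then 1 - F.real A else 1) := by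
    intro i
    by_cases h1 : i ∈ S
    · simp [h1, measureReal_def]
    · by_cases h2 : i ∈ T
      · simpa [h1, h2, measureReal_def] using probReal_compl_eq_one_sub (μ := F) hA
      · simp [h1, h2]
  rw [Finset.prod_congr rfl fun i _ => hterm i, Finset.prod_mul_distrib]
  simp only [Finset.prod_ite_mem, Finset.univ_inter, Finset.prod_const,
    Finset.card_sdiff_of_subset hS]

open scoped Classical in
theorem measurable_card_filter {ι : Type*} [Fintype ι] {A : Set ℝ} (hA : MeasurableSet A)
    (T : Finset ι) : Measurable fun D : ι → ℝ => (T.filter (fun i => D i ∈ A)).card := by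
  simp only [Finset.card_filter]
  refine Finset.measurable_sum _ fun i _ => ?_
  exact Measurable.ite (measurable_pi_apply i hA) measurable_const measurable_const

-- Partition the event by the exact set of indices whose draws land in `A`, then group these sets by
-- cardinality.
open scoped Classical in
theorem measureReal_pi_card_ge {ι : Type*} [Fintype ι] (F : Measure ℝ) [IsProbabilityMeasure F]
    {A : Set ℝ} (hA : MeasurableSet A) (T : Finset ι) (r : ℤ) :
    (Measure.pi fun _ : ι => F).real {D | r ≤ ((T.filter (fun i => D i ∈ A)).card : ℤ)} =
      bernsteinTail r T.card (F.real A) := by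
  rcases lt_or_ge r 0 with hr | hr
  · rw [bernsteinTail_of_nonpos hr.le]
    have : {D : ι → ℝ | r ≤ ((T.filter (fun i => D i ∈ A)).card : ℤ)} = Set.univ := by
      ext D; simp only [Set.mem_ofPred_eq, Set.mem_univ, iff_true]; omega
    rw [this, probReal_univ]
  lift r to ℕ using hr
  have hset : {D : ι → ℝ | (r : ℤ) ≤ ((T.filter (fun i => D i ∈ A)).card : ℤ)} =
      ⋃ S ∈ T.powerset.filter (fun S => r ≤ S.card),
        {D : ι → ℝ | T.filter (fun i => D i ∈ A) = S} := by
    ext D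
    simp
  have hmeas : ∀ S : Finset ι, MeasurableSet {D : ι → ℝ | T.filter (fun i => D i ∈ A) = S} := by
    intro S
    have : {D : ι → ℝ | T.filter (fun i => D i ∈ A) = S} =
        ⋂ i, {D | (i ∈ T ∧ D i ∈ A) ↔ i ∈ S} := by
      ext D; simp [Finset.ext_iff]
    rw [this]
    refine MeasurableSet.iInter fun i => ?_
    have hi : MeasurableSet {D : ι → ℝ | D i ∈ A} := measurable_pi_apply i hA
    exact ((MeasurableSet.const (i ∈ T)).inter hi).iff (MeasurableSet.const (i ∈ S))
  rw [hset, measureReal_biUnion_finset (fun S _ S' _ hne => ?_) (fun S _ => hmeas S)]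
  · rw [Finset.sum_congr rfl fun S hS => measureReal_pi_pattern F hA
      (Finset.mem_powerset.1 (Finset.mem_filter.1 hS).1), Finset.sum_filter]
    rw [Finset.sum_powerset_apply_card (fun j => if r ≤ j then
      F.real A ^ j * (1 - F.real A) ^ (T.card - j) else 0), bernsteinTail_natCast]
    rw [show Finset.Icc r T.card = (Finset.range (T.card + 1)).filter (fun j => r ≤ j) by
      ext j; simp; omega, Finset.sum_filter]
    refine Finset.sum_congr rfl fun j _ => ?_
    split_ifs <;> simp [binomMass, mul_assoc]
  · rw [Function.onFun, Set.disjoint_left]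
    rintro D rfl h
    exact hne h

/-! ### The law of the empirical quantile of the sales. -/

theorem salesCDF_censor_mono {K : ℕ} {n : Fin K → ℕ} (x : Fin K → ℝ) (D : Sample n → ℝ) :
    Monotone (salesCDF (censor x D)) := by
  intro u v huv
  unfold salesCDF
  gcongr with s

theorem salesCDF_one {K : ℕ} {n : Fin K → ℕ} (hn : 1 ≤ ∑ k, n k) {x : Fin K → ℝ}
    (hx : ∀ k, x k ≤ 1) (D : Sample n → ℝ) : salesCDF (censor x D) 1 = 1 := by
  have : (Finset.univ.filter fun s : Sample n => (censor x D s).1 ≤ 1) = Finset.univ :=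
    Finset.filter_true_of_mem fun s _ => (min_le_right _ _).trans (hx s.1)
  rw [salesCDF, this, Finset.card_univ, Fintype.card_sigma]
  simp only [Fintype.card_fin]
  refine div_self ?_
  have : (1 : ℝ) ≤ ((∑ k, n k : ℕ) : ℝ) := by exact_mod_cast hn
  positivity

/-- The empirical distribution function is right-continuous: it is constant just to the right of
each point. -/
theorem exists_salesCDF_eq {K : ℕ} {n : Fin K → ℕ} (I : Info n) (u : ℝ) :
    ∃ w, u < w ∧ ∀ v ∈ Set.Ico u w, salesCDF I v = salesCDF I u := by
  have h : ∀ᶠ v in nhdsWithin u (Set.Ici u), ∀ s : Sample n, (I s).1 ≤ v ↔ (I s).1 ≤ u := by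
    rw [Filter.eventually_all]
    intro s
    rcases le_or_gt (I s).1 u with hs | hs
    · filter_upwards [self_mem_nhdsWithin] with v hv
      exact ⟨fun _ => hs, fun _ => hs.trans hv⟩
    · filter_upwards [nhdsWithin_le_nhds (Iio_mem_nhds hs)] with v hv
      exact ⟨fun h' => absurd (lt_of_le_of_lt h' hv) (lt_irrefl _), fun h' => absurd h' (not_le.2 hs)⟩
  obtain ⟨w, hw, hsub⟩ := mem_nhdsGE_iff_exists_Ico_subset.1 h
  refine ⟨w, hw, fun v hv => ?_⟩
  have := hsub hv
  simp only [Set.mem_ofPred_eq] at this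
  simp only [salesCDF, this]

/-- Right-continuity of the empirical distribution function makes the infimum satisfy its own
constraint; the constraint set is nonempty because it contains `1`. -/
theorem bsaa_le_iff {K : ℕ} {n : Fin K → ℕ} (hn : 1 ≤ ∑ k, n k) {q : ℝ} (hq1 : q ≤ 1)
    {x : Fin K → ℝ} (hx : ∀ k, x k ≤ 1) (D : Sample n → ℝ) {u : ℝ} (hu : u ∈ Set.Icc (0 : ℝ) 1) :
    bsaa n q x (censor x D) ≤ u ↔ q ≤ salesCDF (censor x D) u := by
  have hbdd : BddBelow {u : ℝ | u ∈ Set.Icc (0 : ℝ) 1 ∧ q ≤ salesCDF (censor x D) u} :=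
    ⟨0, fun y hy => hy.1.1⟩
  have hne : {u : ℝ | u ∈ Set.Icc (0 : ℝ) 1 ∧ q ≤ salesCDF (censor x D) u}.Nonempty :=
    ⟨1, by simp, by rwa [salesCDF_one hn hx]⟩
  constructor
  · intro h
    obtain ⟨w, hw, hc⟩ := exists_salesCDF_eq (censor x D) u
    obtain ⟨y, hy, hyw⟩ := exists_lt_of_csInf_lt hne (h.trans_lt hw)
    rcases le_or_gt y u with hyu | hyu
    · exact hy.2.trans (salesCDF_censor_mono x D hyu)
    · rw [← hc y ⟨hyu.le, hyw⟩]; exact hy.2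
  · intro h
    exact csInf_le hbdd ⟨hu, h⟩

theorem breakpoint_zero {K : ℕ} (x : Fin K → ℝ) : breakpoint x 0 = 0 := rfl

theorem breakpoint_last {K : ℕ} (x : Fin K → ℝ) : breakpoint x (Fin.last (K + 1)) = 1 := by
  rw [breakpoint, ← Fin.succ_last, Fin.cons_succ, Fin.snoc_last]

theorem breakpoint_succ_castSucc {K : ℕ} (x : Fin K → ℝ) (l : Fin K) :
    breakpoint x l.castSucc.succ = x l := by
  rw [breakpoint, Fin.cons_succ, Fin.snoc_castSucc]

theorem breakpoint_mem {K : ℕ} {x : Fin K → ℝ} (hx : ∀ k, x k ∈ Set.Icc (0 : ℝ) 1)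
    (k : Fin (K + 2)) : breakpoint x k ∈ Set.Icc (0 : ℝ) 1 := by
  induction k using Fin.cases with
  | zero => simp [breakpoint_zero]
  | succ k =>
    induction k using Fin.lastCases with
    | last => rw [Fin.succ_last, breakpoint_last]; simp
    | cast l => rw [breakpoint_succ_castSucc]; exact hx l

theorem breakpoint_mono {K : ℕ} {x : Fin K → ℝ} (hx : ∀ k, x k ∈ Set.Icc (0 : ℝ) 1)
    (hmono : Monotone x) : Monotone (breakpoint x) := by
  intro a b hab
  induction a using Fin.cases with
  | zero => exact (breakpoint_mem hx b).1
  | succ a =>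
    induction b using Fin.cases with
    | zero => simp at hab
    | succ b =>
      rw [Fin.succ_le_succ_iff] at hab
      induction b using Fin.lastCases with
      | last => rw [Fin.succ_last, breakpoint_last]; exact (breakpoint_mem hx _).2
      | cast b =>
        induction a using Fin.lastCases with
        | last => simp at hab
        | cast a =>
          rw [breakpoint_succ_castSucc, breakpoint_succ_castSucc]
          exact hmono (by simpa using hab)

theorem le_of_breakpoint_le {K : ℕ} {x : Fin K → ℝ} (hx : ∀ k, x k ∈ Set.Icc (0 : ℝ) 1)
    (hmono : Monotone x) {k : Fin (K + 1)} {u : ℝ}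
    (hu : u ∈ Set.Ico (breakpoint x k.castSucc) (breakpoint x k.succ)) (l : Fin K) :
    x l ≤ u ↔ (l : ℕ) < k := by
  rw [← breakpoint_succ_castSucc x l]
  constructor
  · intro h
    by_contra hlk
    refine absurd (h.trans_lt hu.2) (not_lt.2 (breakpoint_mono hx hmono ?_))
    rw [Fin.le_def]; simpa using hlk
  · intro h
    refine (breakpoint_mono hx hmono ?_).trans hu.1
    rw [Fin.le_def]; simpa using h

-- Samples from levels at most `u` contribute deterministically, giving `σ_k`; at higher levels
-- censoring does not affect the event that the sale is at most `u`.
open scoped Classical in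
theorem card_sales_le {K : ℕ} {n : Fin K → ℕ} {x : Fin K → ℝ}
    (hx : ∀ k, x k ∈ Set.Icc (0 : ℝ) 1) (hmono : Monotone x) {k : Fin (K + 1)} {u : ℝ}
    (hu : u ∈ Set.Ico (breakpoint x k.castSucc) (breakpoint x k.succ)) (D : Sample n → ℝ) :
    (Finset.univ.filter fun s : Sample n => (censor x D s).1 ≤ u).card =
      cumCount n k + ((Finset.univ.filter fun s : Sample n => ¬ (s.1 : ℕ) < k).filter
        fun s => D s ∈ Set.Iic u).card := by
  rw [← Finset.card_filter_add_card_filter_not (s := Finset.univ.filter _)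
    (fun s : Sample n => (s.1 : ℕ) < k)]
  congr 1
  · have : Finset.filter (fun s : Sample n => (s.1 : ℕ) < k)
        (Finset.univ.filter fun s : Sample n => (censor x D s).1 ≤ u) =
        (Finset.univ.filter fun l : Fin K => (l : ℕ) < k).sigma fun _ => Finset.univ := by
      ext s
      simp only [Finset.mem_filter, Finset.mem_univ, true_and, Finset.mem_sigma, and_true,
        and_iff_right_iff_imp]
      intro h
      exact (min_le_right _ _).trans ((le_of_breakpoint_le hx hmono hu s.1).2 h)
    rw [this, Finset.card_sigma, cumCount]
    simp
  · congr 1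
    ext s
    simp only [Finset.mem_filter, Finset.mem_univ, true_and, Set.mem_Iic, censor, min_le_iff]
    rw [le_of_breakpoint_le hx hmono hu s.1]
    tauto

open scoped Classical in
theorem card_uncensored {K : ℕ} (n : Fin K → ℕ) (k : Fin (K + 1)) :
    (Finset.univ.filter fun s : Sample n => ¬ (s.1 : ℕ) < k).card = (∑ l, n l) - cumCount n k := by
  have h := Finset.card_filter_add_card_filter_not (s := (Finset.univ : Finset (Sample n)))
    (fun s : Sample n => (s.1 : ℕ) < k)
  have h1 : (Finset.univ.filter fun s : Sample n => (s.1 : ℕ) < k) =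
      (Finset.univ.filter fun l : Fin K => (l : ℕ) < k).sigma fun _ => Finset.univ := by
    ext s; simp
  have h2 : (Finset.univ.filter fun s : Sample n => (s.1 : ℕ) < k).card = cumCount n k := by
    rw [h1, Finset.card_sigma, cumCount]; simp
  have h3 : (Finset.univ : Finset (Sample n)).card = ∑ l, n l := by
    rw [Finset.card_univ, Fintype.card_sigma]; simp
  omega

theorem le_salesCDF_iff {K : ℕ} {n : Fin K → ℕ} (hn : 1 ≤ ∑ k, n k) (q : ℝ) (I : Info n) (u : ℝ) :
    q ≤ salesCDF I u ↔ ⌈q * ((∑ l, n l : ℕ) : ℝ)⌉ ≤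
      ((Finset.univ.filter fun s : Sample n => (I s).1 ≤ u).card : ℤ) := by
  have : (0 : ℝ) < ((∑ k, n k : ℕ) : ℝ) := by exact_mod_cast hn
  rw [salesCDF, le_div_iff₀ this, Int.ceil_le]
  norm_cast

/-- The law of the Biased SAA order between two consecutive inventory levels. -/
theorem measureReal_bsaa_le {K : ℕ} {n : Fin K → ℕ} (hn : 1 ≤ ∑ k, n k) {q : ℝ} (hq1 : q ≤ 1)
    {x : Fin K → ℝ} (hx : ∀ k, x k ∈ Set.Icc (0 : ℝ) 1) (hmono : Monotone x)
    (F : Measure ℝ) [IsProbabilityMeasure F] {k : Fin (K + 1)} {u : ℝ}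
    (hu : u ∈ Set.Ico (breakpoint x k.castSucc) (breakpoint x k.succ)) :
    (Measure.pi fun _ : Sample n => F).real {D | bsaa n q x (censor x D) ≤ u} =
      bernsteinTail (⌈q * ((∑ l, n l : ℕ) : ℝ)⌉ - (cumCount n k : ℤ))
        ((∑ l, n l) - cumCount n k) (F.real (Set.Iic u)) := by
  classical
  have hu01 : u ∈ Set.Icc (0 : ℝ) 1 :=
    ⟨(breakpoint_mem hx _).1.trans hu.1, hu.2.le.trans (breakpoint_mem hx _).2⟩
  rw [← card_uncensored n k, ← measureReal_pi_card_ge F measurableSet_Iic]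
  congr 1
  ext D
  simp only [Set.mem_ofPred_eq]
  rw [bsaa_le_iff hn hq1 (fun k => (hx k).2) D hu01, le_salesCDF_iff hn,
    card_sales_le hx hmono hu D]
  rw [Nat.cast_add]
  exact sub_le_iff_le_add'.symm

theorem measurable_bsaa {K : ℕ} {n : Fin K → ℕ} (hn : 1 ≤ ∑ k, n k) {q : ℝ} (hq1 : q ≤ 1)
    {x : Fin K → ℝ} (hx : ∀ k, x k ∈ Set.Icc (0 : ℝ) 1) :
    Measurable fun D : Sample n → ℝ => bsaa n q x (censor x D) := by
  classical
  refine measurable_of_Iic fun u => ?_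
  rcases lt_or_ge u 0 with h0 | h0
  · convert MeasurableSet.empty using 1
    ext D
    simp only [Set.mem_preimage, Set.mem_Iic, Set.mem_empty_iff_false, iff_false, not_le]
    exact h0.trans_le (bsaa_mem_Icc n q x _).1
  rcases lt_or_ge 1 u with h1 | h1
  · convert MeasurableSet.univ using 1
    ext D
    simp only [Set.mem_preimage, Set.mem_Iic, Set.mem_univ, iff_true]
    exact (bsaa_mem_Icc n q x _).2.trans h1.le
  have : (fun D : Sample n → ℝ => bsaa n q x (censor x D)) ⁻¹' Set.Iic u =
      (fun D => (Finset.univ.filter fun s : Sample n => (censor x D s).1 ≤ u).card) ⁻¹'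
        {c : ℕ | ⌈q * ((∑ l, n l : ℕ) : ℝ)⌉ ≤ (c : ℤ)} := by
    ext D
    simp only [Set.mem_preimage, Set.mem_Iic, Set.mem_ofPred_eq]
    rw [bsaa_le_iff hn hq1 (fun k => (hx k).2) D ⟨h0, h1⟩, le_salesCDF_iff hn]
  rw [this]
  refine Measurable.comp (g := fun S : Sample n → ℝ =>
      (Finset.univ.filter fun s : Sample n => S s ∈ Set.Iic u).card)
    (f := fun D : Sample n → ℝ => fun s => min (D s) (x s.1))
    (measurable_card_filter measurableSet_Iic _) ?_ (MeasurableSet.of_discrete)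
  fun_prop

/-! ### Cost and regret as integrals of the distribution function. -/

theorem ae_mem_Icc_of_mem_demandLaws {F : Measure ℝ} (hF : F ∈ demandLaws) :
    ∀ᵐ d ∂F, d ∈ Set.Icc (0 : ℝ) 1 := by
  rw [ae_iff]; exact hF.2

theorem monotone_measureReal_Iic (F : Measure ℝ) [IsFiniteMeasure F] :
    Monotone fun u => F.real (Set.Iic u) := fun _ _ h =>
  measureReal_mono (Set.Iic_subset_Iic.2 h)

theorem integrable_max_sub {F : Measure ℝ} (hF : F ∈ demandLaws) (a : ℝ) :
    Integrable (fun d => max (a - d) 0) F := by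
  have := hF.1
  refine Integrable.of_bound (by fun_prop) (|a| + 1) ?_
  filter_upwards [ae_mem_Icc_of_mem_demandLaws hF] with d hd
  rw [Real.norm_eq_abs, abs_of_nonneg (le_max_right _ _)]
  have := le_abs_self a
  have := abs_nonneg a
  exact max_le (by linarith [hd.1]) (by linarith)

theorem integrable_id_of_mem_demandLaws {F : Measure ℝ} (hF : F ∈ demandLaws) :
    Integrable (fun d => d) F := by
  have := hF.1
  refine Integrable.of_bound (by fun_prop) 1 ?_
  filter_upwards [ae_mem_Icc_of_mem_demandLaws hF] with d hd
  rw [Real.norm_eq_abs, abs_of_nonneg hd.1]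
  exact hd.2

theorem integral_max_sub {F : Measure ℝ} (hF : F ∈ demandLaws) (a : ℝ) :
    ∫ d, max (a - d) 0 ∂F = ∫ u in Set.Ioo 0 a, F.real (Set.Iic u) := by
  have := hF.1
  have hint : Integrable (Function.uncurry fun d u : ℝ => if d ≤ u then (1 : ℝ) else 0)
      (F.prod (volume.restrict (Set.Ioo 0 a))) := by
    refine Integrable.of_bound ?_ 1 (Filter.Eventually.of_forall fun p => ?_)
    · exact (Measurable.ite (measurableSet_le measurable_fst measurable_snd) measurable_const
        measurable_const).aestronglyMeasurable
    · simp only [Function.uncurry]; split_ifs <;> simp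
  calc ∫ d, max (a - d) 0 ∂F
      = ∫ d, (∫ u in Set.Ioo 0 a, (if d ≤ u then (1 : ℝ) else 0)) ∂F := by
        refine integral_congr_ae ?_
        filter_upwards [ae_mem_Icc_of_mem_demandLaws hF] with d hd
        have : (fun u => if d ≤ u then (1 : ℝ) else 0) = (Set.Ici d).indicator fun _ => 1 := by
          ext u; simp [Set.indicator]
        rw [this, setIntegral_indicator measurableSet_Ici, setIntegral_const, smul_eq_mul, mul_one,
          -- The sets differ at most at `d` and `a`; demand being nonnegative removes the constraint
          -- `0 < u`.
          measureReal_congr (show (Set.Ioo 0 a ∩ Set.Ici d : Set ℝ) =ᵐ[volume] Set.Ioc d a from ?_),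
          Real.volume_real_Ioc]
        have h1 : ∀ᵐ u : ℝ, u ≠ d := by simp [ae_iff]
        have h2 : ∀ᵐ u : ℝ, u ≠ a := by simp [ae_iff]
        filter_upwards [h1, h2] with u hu1 hu2
        refine propext ⟨fun h => ⟨lt_of_le_of_ne h.2 (Ne.symm hu1), h.1.2.le⟩, fun h =>
          ⟨⟨hd.1.trans_lt h.1, lt_of_le_of_ne h.2 hu2⟩, h.1.le⟩⟩
    _ = ∫ u in Set.Ioo 0 a, (∫ d, (if d ≤ u then (1 : ℝ) else 0) ∂F) := integral_integral_swap hint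
    _ = ∫ u in Set.Ioo 0 a, F.real (Set.Iic u) := by
        congr 1
        ext u
        have : (fun d => if d ≤ u then (1 : ℝ) else 0) = (Set.Iic u).indicator fun _ => 1 := by
          ext d; simp [Set.indicator]
        rw [this, integral_indicator measurableSet_Iic]
        simp

/-- The contribution to the regret of order `a` at the point `u`, where the demand distribution
function equals `g`. -/
noncomputable def pointwiseRegret (q g a u : ℝ) : ℝ :=
  (if u < a then g - q else 0) + max (q - g) 0

theorem integrableOn_cdf_sub (F : Measure ℝ) [IsProbabilityMeasure F] (q : ℝ) {s : Set ℝ}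
    (hs : volume s ≠ ⊤) : IntegrableOn (fun u => F.real (Set.Iic u) - q) s := by
  have : IsFiniteMeasure (volume.restrict s) := ⟨by simpa using hs.lt_top⟩
  refine Integrable.sub ?_ (integrable_const q)
  refine Integrable.of_bound (monotone_measureReal_Iic F).measurable.aestronglyMeasurable 1
    (Filter.Eventually.of_forall fun u => ?_)
  rw [Real.norm_eq_abs, abs_of_nonneg measureReal_nonneg]
  exact measureReal_le_one

theorem integrableOn_max_sub_cdf (F : Measure ℝ) [IsProbabilityMeasure F] (q : ℝ) {s : Set ℝ}
    (hs : volume s ≠ ⊤) : IntegrableOn (fun u => max (q - F.real (Set.Iic u)) 0) s := by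
  have := (integrableOn_cdf_sub F q hs).neg.pos_part
  simpa [IntegrableOn] using this

theorem expectedCost_eq {F : Measure ℝ} (hF : F ∈ demandLaws) (cu co q : ℝ)
    (hq : cu = (cu + co) * q) {a : ℝ} (ha : a ∈ Set.Icc (0 : ℝ) 1) :
    expectedCost cu co a F = cu * ∫ d, d ∂F +
      (cu + co) * ∫ u in Set.Ioc 0 1, if u < a then F.real (Set.Iic u) - q else 0 := by
  have := hF.1
  have hcost : ∀ d, cost cu co a d = (cu + co) * max (a - d) 0 + cu * d - cu * a := by
    intro d
    unfold cost
    rcases le_total a d with h | h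
    · rw [max_eq_right (by linarith), max_eq_left (by linarith)]; ring
    · rw [max_eq_left (by linarith), max_eq_right (by linarith)]; ring
  have h1 : (fun u => if u < a then F.real (Set.Iic u) - q else 0) =
      (Set.Iio a).indicator fun u => F.real (Set.Iic u) - q := by
    ext u; simp [Set.indicator]
  have h2 : Set.Ioc 0 1 ∩ Set.Iio a = Set.Ioo 0 a := by
    ext u
    simp only [Set.mem_inter_iff, Set.mem_Ioc, Set.mem_Iio, Set.mem_Ioo]
    exact ⟨fun h => ⟨h.1.1, h.2⟩, fun h => ⟨⟨h.1, h.2.le.trans ha.2⟩, h.2⟩⟩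
  have hG : IntegrableOn (fun u => F.real (Set.Iic u)) (Set.Ioo 0 a) := by
    simpa using integrableOn_cdf_sub F 0 (s := Set.Ioo 0 a) (by simp)
  rw [h1, setIntegral_indicator measurableSet_Iio, h2,
    integral_sub hG (integrable_const q), ← integral_max_sub hF a, setIntegral_const,
    Real.volume_real_Ioo_of_le ha.1]
  simp only [expectedCost, hcost]
  have hi1 := (integrable_max_sub hF a).const_mul (cu + co)
  have hi2 := (integrable_id_of_mem_demandLaws hF).const_mul cu
  rw [integral_sub (f := fun d => (cu + co) * max (a - d) 0 + cu * d) (hi1.add hi2)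
      (integrable_const _), integral_add hi1 hi2, integral_const_mul, integral_const_mul,
    integral_const, probReal_univ]
  simp only [smul_eq_mul]
  linear_combination (-a) * hq

theorem integrableOn_ite_cdf_sub (F : Measure ℝ) [IsProbabilityMeasure F] (q a : ℝ) :
    IntegrableOn (fun u => if u < a then F.real (Set.Iic u) - q else 0) (Set.Ioc 0 1) := by
  have h1 : (fun u => if u < a then F.real (Set.Iic u) - q else 0) =
      (Set.Iio a).indicator fun u => F.real (Set.Iic u) - q := by
    ext u; simp [Set.indicator]
  rw [h1]
  exact Integrable.indicator (integrableOn_cdf_sub F q (by simp)) measurableSet_Iio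

/-- The integrand in `expectedCost_eq` is at least `-(q - F(u))⁺` pointwise, and ordering up to the
last point where `F < q` attains this bound almost everywhere. -/
theorem optCost_eq {F : Measure ℝ} (hF : F ∈ demandLaws) {cu co q : ℝ}
    (hc : 0 ≤ cu + co) (hq : cu = (cu + co) * q) :
    optCost cu co F = cu * ∫ d, d ∂F -
      (cu + co) * ∫ u in Set.Ioc 0 1, max (q - F.real (Set.Iic u)) 0 := by
  have := hF.1
  have hmax := integrableOn_max_sub_cdf F q (s := Set.Ioc 0 1) (by simp)
  have hlow : ∀ a : Set.Icc (0 : ℝ) 1, cu * ∫ d, d ∂F -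
      (cu + co) * ∫ u in Set.Ioc 0 1, max (q - F.real (Set.Iic u)) 0 ≤
        expectedCost cu co a F := by
    intro a
    rw [expectedCost_eq hF cu co q hq a.2, sub_eq_add_neg, ← mul_neg, ← integral_neg]
    refine add_le_add_right (mul_le_mul_of_nonneg_left (setIntegral_mono_on hmax.neg
      (integrableOn_ite_cdf_sub F q a) measurableSet_Ioc fun u _ => ?_) hc) _
    have h1 := le_max_left (q - F.real (Set.Iic u)) 0
    have h2 := le_max_right (q - F.real (Set.Iic u)) 0
    rw [Pi.neg_apply]
    split_ifs <;> linarith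
  refine le_antisymm ?_ (le_ciInf hlow)
  -- Inserting `0` keeps the set nonempty when `F ≥ q` throughout, and the optimal order is then
  -- `0`.
  set s : Set ℝ := insert 0 {u | u ∈ Set.Icc (0 : ℝ) 1 ∧ F.real (Set.Iic u) < q} with hs
  have hsub : s ⊆ Set.Icc 0 1 := by
    rintro u (rfl | hu)
    · simp
    · exact hu.1
  have hne : s.Nonempty := ⟨0, Or.inl rfl⟩
  have hbdd : BddAbove s := ⟨1, fun u hu => (hsub hu).2⟩
  have hmem : sSup s ∈ Set.Icc (0 : ℝ) 1 :=
    ⟨le_csSup hbdd (Or.inl rfl), csSup_le hne fun u hu => (hsub hu).2⟩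
  refine (ciInf_le ⟨_, Set.forall_mem_range.2 hlow⟩ ⟨sSup s, hmem⟩).trans_eq ?_
  rw [expectedCost_eq hF cu co q hq hmem, sub_eq_add_neg, ← mul_neg, ← integral_neg]
  congr 2
  refine setIntegral_congr_ae measurableSet_Ioc ?_
  have hae : ∀ᵐ u : ℝ, u ≠ sSup s := by simp [ae_iff]
  filter_upwards [hae] with u hu hu01
  rcases lt_or_gt_of_ne hu with h | h
  · obtain ⟨y, hy, huy⟩ := exists_lt_of_lt_csSup hne h
    rcases hy with rfl | hy
    · exact absurd hu01.1 (not_lt.2 huy.le)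
    · have := monotone_measureReal_Iic F huy.le
      have := hy.2
      dsimp only at *
      rw [if_pos h, max_eq_left (by linarith)]; ring
  · rw [if_neg (not_lt.2 h.le), max_eq_right, neg_zero]
    by_contra hcon
    exact absurd (le_csSup hbdd (Or.inr ⟨⟨hu01.1.le, hu01.2⟩, by linarith⟩)) (not_le.2 h)

theorem regret_eq {F : Measure ℝ} (hF : F ∈ demandLaws) {cu co q : ℝ}
    (hc : 0 ≤ cu + co) (hq : cu = (cu + co) * q) {a : ℝ} (ha : a ∈ Set.Icc (0 : ℝ) 1) :
    regret cu co a F =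
      (cu + co) * ∫ u in Set.Ioc 0 1, pointwiseRegret q (F.real (Set.Iic u)) a u := by
  have := hF.1
  unfold pointwiseRegret
  rw [regret, expectedCost_eq hF cu co q hq ha, optCost_eq hF hc hq,
    integral_add (integrableOn_ite_cdf_sub F q a) (integrableOn_max_sub_cdf F q (by simp))]
  ring

theorem integrable_pointwiseRegret {Ω : Type*} [MeasurableSpace Ω] (P : Measure Ω)
    [IsProbabilityMeasure P] (F : Measure ℝ) [IsProbabilityMeasure F] (q : ℝ) {a : Ω → ℝ}
    (ha : Measurable a) :
    Integrable (Function.uncurry fun ω u => pointwiseRegret q (F.real (Set.Iic u)) (a ω) u)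
      (P.prod (volume.restrict (Set.Ioc 0 1))) := by
  have hG : Measurable fun p : Ω × ℝ => F.real (Set.Iic p.2) :=
    (monotone_measureReal_Iic F).measurable.comp measurable_snd
  refine Integrable.of_bound ?_ ((1 + |q|) + (|q| + 1)) (Filter.Eventually.of_forall fun p => ?_)
  · refine Measurable.aestronglyMeasurable (Measurable.add ?_ ?_)
    · exact Measurable.ite (measurableSet_lt measurable_snd (ha.comp measurable_fst))
        (hG.sub_const q) measurable_const
    · exact (measurable_const.sub hG).max measurable_const
  · have h0 : 0 ≤ F.real (Set.Iic p.2) := measureReal_nonneg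
    have h1 : F.real (Set.Iic p.2) ≤ 1 := measureReal_le_one
    have hq := abs_nonneg q
    have hq1 := le_abs_self q
    have hq2 := neg_abs_le q
    simp only [Function.uncurry, pointwiseRegret]
    refine (norm_add_le _ _).trans (add_le_add ?_ ?_)
    · split_ifs
      · rw [Real.norm_eq_abs, abs_le]; constructor <;> linarith
      · rw [norm_zero]; linarith
    · rw [Real.norm_eq_abs, abs_of_nonneg (le_max_right _ _)]
      exact max_le (by linarith) (by linarith)

theorem integral_pointwiseRegret {Ω : Type*} [MeasurableSpace Ω] (P : Measure Ω)
    [IsProbabilityMeasure P] (q g u : ℝ) {a : Ω → ℝ} (ha : Measurable a) :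
    ∫ ω, pointwiseRegret q g (a ω) u ∂P =
      (1 - P.real {ω | a ω ≤ u}) * (g - q) + max (q - g) 0 := by
  have hm : MeasurableSet {ω | u < a ω} := measurableSet_lt measurable_const ha
  have h1 : (fun ω => if u < a ω then g - q else 0) =
      {ω | u < a ω}.indicator fun _ => g - q := by
    ext ω; simp [Set.indicator]
  have h2 : {ω | u < a ω} = {ω | a ω ≤ u}ᶜ := by ext ω; simp
  unfold pointwiseRegret
  rw [integral_add (by rw [h1]; exact (integrable_const _).indicator hm) (integrable_const _), h1,
    integral_indicator hm, setIntegral_const, h2,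
    probReal_compl_eq_one_sub (measurableSet_le ha measurable_const)]
  simp

/-! ### Expected regret as a sum over the inventory intervals. -/

theorem sum_integral_breakpoint {K : ℕ} (x : Fin K → ℝ)
    (hx : ∀ k, x k ∈ Set.Icc (0 : ℝ) 1) {f : ℝ → ℝ} (hf : IntegrableOn f (Set.Icc 0 1)) :
    ∫ u in Set.Ioc 0 1, f u =
      ∑ k : Fin (K + 1), ∫ u in breakpoint x k.castSucc..breakpoint x k.succ, f u := by
  set b : ℕ → ℝ := fun k => if h : k < K + 2 then breakpoint x ⟨k, h⟩ else 1 with hb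
  have hbm : ∀ k, b k ∈ Set.Icc (0 : ℝ) 1 := by
    intro k
    simp only [hb]
    split_ifs
    · exact breakpoint_mem hx _
    · simp
  have h := intervalIntegral.sum_integral_adjacent_intervals (f := f) (μ := volume) (a := b)
    (n := K + 1) fun k _ => by
      refine IntegrableOn.intervalIntegrable (hf.mono_set ?_)
      exact Set.uIcc_subset_Icc (hbm k) (hbm (k + 1))
  have hb0 : b 0 = 0 := by simp [hb, breakpoint_zero]
  have hb1 : b (K + 1) = 1 := by
    simp only [hb]; rw [dif_pos (by omega)]; exact breakpoint_last x
  rw [hb0, hb1, intervalIntegral.integral_of_le zero_le_one] at h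
  rw [← h, Finset.sum_range]
  refine Finset.sum_congr rfl fun k _ => ?_
  simp only [hb]
  rw [dif_pos (by omega), dif_pos (by omega)]
  rfl

section

variable {K : ℕ} {n : Fin K → ℕ} {cu co q : ℝ} {x : Fin K → ℝ} {F : Measure ℝ}

theorem integrable_regret_bsaa (hn : 1 ≤ ∑ k, n k) (hc : 0 ≤ cu + co)
    (hq : cu = (cu + co) * q) (hq1 : q ≤ 1) (hx : ∀ k, x k ∈ Set.Icc (0 : ℝ) 1)
    (hF : F ∈ demandLaws) :
    Integrable (fun D : Sample n → ℝ => regret cu co (bsaa n q x (censor x D)) F)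
      (Measure.pi fun _ : Sample n => F) := by
  have := hF.1
  simp only [regret_eq hF hc hq (bsaa_mem_Icc n q x _)]
  exact ((integrable_pointwiseRegret _ F q (measurable_bsaa hn hq1 hx)).integral_prod_left).const_mul
    (cu + co)

/-- Fubini moves the sample average inside the integral over `u`, where only `P(order ≤ u)` enters.
-/
theorem expectedRegret_eq (hn : 1 ≤ ∑ k, n k) (hc : 0 ≤ cu + co)
    (hq : cu = (cu + co) * q) (hq1 : q ≤ 1) (hx : ∀ k, x k ∈ Set.Icc (0 : ℝ) 1)
    (hmono : Monotone x) (hF : F ∈ demandLaws) :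
    expectedRegret cu co (bsaa n q) x F = (cu + co) * ∑ k : Fin (K + 1),
      ∫ u in breakpoint x k.castSucc..breakpoint x k.succ, psi n q k (F.real (Set.Iic u)) := by
  have := hF.1
  have hm := measurable_bsaa (q := q) hn hq1 hx
  have hint := integrable_pointwiseRegret (Measure.pi fun _ : Sample n => F) F q hm
  rw [expectedRegret]
  simp only [regret_eq hF hc hq (bsaa_mem_Icc n q x _)]
  rw [integral_const_mul, integral_integral_swap hint, sum_integral_breakpoint x hx]
  · congr 1
    refine Finset.sum_congr rfl fun k _ => ?_
    have hle : breakpoint x k.castSucc ≤ breakpoint x k.succ :=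
      breakpoint_mono hx hmono (Fin.castSucc_lt_succ).le
    rw [intervalIntegral.integral_of_le hle, intervalIntegral.integral_of_le hle,
      integral_Ioc_eq_integral_Ioo, integral_Ioc_eq_integral_Ioo]
    refine setIntegral_congr_fun measurableSet_Ioo fun u hu => ?_
    rw [integral_pointwiseRegret _ _ _ _ hm,
      measureReal_bsaa_le hn hq1 hx hmono F (Set.Ioo_subset_Ico_self hu)]
    rfl
  · rw [integrableOn_Icc_iff_integrableOn_Ioc]
    exact hint.integral_prod_right

end

/-! ### Pooling and the upper bound. -/

/-- Pooling: under single crossing in the index, replacing a nondecreasing family of values by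
one of them does not decrease the weighted sum. -/
theorem exists_sum_le_sum_const {ι : Type*} [LinearOrder ι] (S : Finset ι) (L : ι → ℝ)
    (hL : ∀ k, 0 ≤ L k) (ψ : ι → ℝ → ℝ) (v : ι → ℝ) (hv : Monotone v)
    (hsc : ∀ k ∈ S, ∀ l ∈ S, k ≤ l → ∀ a ∈ S, ∀ b ∈ S, v a ≤ v b →
      ψ k (v b) ≤ ψ k (v a) → ψ l (v b) ≤ ψ l (v a)) (hS : S.Nonempty) :
    ∃ j ∈ S, ∑ k ∈ S, L k * ψ k (v k) ≤ ∑ k ∈ S, L k * ψ k (v j) := by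
  induction S using Finset.induction_on_max with
  | empty => simp at hS
  | insert m S hm ih =>
    have hmS : m ∉ S := fun h => lt_irrefl _ (hm m h)
    rcases S.eq_empty_or_nonempty with rfl | hne
    · exact ⟨m, by simp, by simp⟩
    obtain ⟨j, hj, hle⟩ := ih (fun k hk l hl hkl a ha b hb =>
      hsc k (Finset.mem_insert_of_mem hk) l (Finset.mem_insert_of_mem hl) hkl a
        (Finset.mem_insert_of_mem ha) b (Finset.mem_insert_of_mem hb)) hne
    -- Either the old indices do at least as well at the new value `v m`, or some `k < m` prefers `v
    -- j`; single crossing then passes this preference on to `m`.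
    by_cases hcase : ∑ k ∈ S, L k * ψ k (v j) ≤ ∑ k ∈ S, L k * ψ k (v m)
    · refine ⟨m, Finset.mem_insert_self _ _, ?_⟩
      rw [Finset.sum_insert hmS, Finset.sum_insert hmS]
      linarith
    · refine ⟨j, Finset.mem_insert_of_mem hj, ?_⟩
      obtain ⟨k, hk, hlt⟩ := Finset.exists_lt_of_sum_lt (not_le.1 hcase)
      have h1 : ψ k (v m) ≤ ψ k (v j) := (lt_of_mul_lt_mul_left hlt (hL k)).le
      have h2 := hsc k (Finset.mem_insert_of_mem hk) m (Finset.mem_insert_self _ _) (hm k hk).le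
        j (Finset.mem_insert_of_mem hj) m (Finset.mem_insert_self _ _) (hv (hm j hj).le) h1
      rw [Finset.sum_insert hmS, Finset.sum_insert hmS]
      have := mul_le_mul_of_nonneg_left h2 (hL m)
      linarith

section

variable {K : ℕ} {n : Fin K → ℕ} {cu co q : ℝ} {x : Fin K → ℝ} {F : Measure ℝ}

theorem objective_eq_sum (i : ℤ) (v w : ℝ) :
    objective n q x i v w = ∑ k : Fin (K + 1), (breakpoint x k.succ - breakpoint x k.castSucc) *
      psi n q k (if ((k : ℕ) : ℤ) ≤ i then v else w) := by
  rw [objective, ← Finset.sum_filter_add_sum_filter_not Finset.univ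
    (fun k : Fin (K + 1) => ((k : ℕ) : ℤ) ≤ i)]
  congr 1
  · refine Finset.sum_congr rfl fun k hk => ?_
    rw [if_pos (Finset.mem_filter.1 hk).2]
  · simp only [not_le]
    refine Finset.sum_congr rfl fun k hk => ?_
    rw [if_neg (not_le.2 (Finset.mem_filter.1 hk).2)]

theorem continuous_objective (i : ℤ) :
    Continuous fun p : Set.Icc (0 : ℝ) q × Set.Icc q (1 : ℝ) => objective n q x i p.1 p.2 := by
  unfold objective
  refine Continuous.add (continuous_finsetSum _ fun k _ => ?_)
    (continuous_finsetSum _ fun k _ => ?_)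
  · exact continuous_const.mul
      ((continuous_psi n q k).comp (continuous_subtype_val.comp continuous_fst))
  · exact continuous_const.mul
      ((continuous_psi n q k).comp (continuous_subtype_val.comp continuous_snd))

theorem breakpoint_castSucc_le_succ (hx : ∀ k, x k ∈ Set.Icc (0 : ℝ) 1) (hmono : Monotone x)
    (k : Fin (K + 1)) : breakpoint x k.castSucc ≤ breakpoint x k.succ :=
  breakpoint_mono hx hmono (Fin.castSucc_lt_succ).le

theorem expectedRegret_eq_objective (hn : 1 ≤ ∑ k, n k) (hc : 0 ≤ cu + co)
    (hq : cu = (cu + co) * q) (hq1 : q ≤ 1) (hx : ∀ k, x k ∈ Set.Icc (0 : ℝ) 1)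
    (hmono : Monotone x) (hF : F ∈ demandLaws) (i : ℤ) (v w : ℝ)
    (hcdf : ∀ k : Fin (K + 1), ∀ u ∈ Set.Ico (breakpoint x k.castSucc) (breakpoint x k.succ),
      F.real (Set.Iic u) = if ((k : ℕ) : ℤ) ≤ i then v else w) :
    expectedRegret cu co (bsaa n q) x F = (cu + co) * objective n q x i v w := by
  rw [expectedRegret_eq hn hc hq hq1 hx hmono hF, objective_eq_sum]
  congr 1
  refine Finset.sum_congr rfl fun k _ => ?_
  rw [intervalIntegral.integral_of_le (breakpoint_castSucc_le_succ hx hmono k),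
    integral_Ioc_eq_integral_Ioo, setIntegral_congr_fun measurableSet_Ioo
      (g := fun _ => psi n q k (if ((k : ℕ) : ℤ) ≤ i then v else w))
      (fun u hu => by rw [hcdf k u (Set.Ioo_subset_Ico_self hu)]),
    setIntegral_const, Real.volume_real_Ioo_of_le (breakpoint_castSucc_le_succ hx hmono k),
    smul_eq_mul]

theorem intervalIntegrable_psi_cdf [IsProbabilityMeasure F] (k : Fin (K + 1)) (a b : ℝ) :
    IntervalIntegrable (fun u => psi n q k (F.real (Set.Iic u))) volume a b := by
  obtain ⟨C, hC⟩ := (isCompact_Icc (a := (0 : ℝ)) (b := 1)).exists_bound_of_continuousOn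
    (continuous_psi n q k).continuousOn
  rw [intervalIntegrable_iff]
  have : IsFiniteMeasure (volume.restrict (Set.uIoc a b)) :=
    ⟨by simp [Set.uIoc]⟩
  refine Integrable.of_bound ((continuous_psi n q k).measurable.comp
    (monotone_measureReal_Iic F).measurable).aestronglyMeasurable C
    (Filter.Eventually.of_forall fun u => hC _ ⟨measureReal_nonneg, measureReal_le_one⟩)

/-- Each interval between consecutive inventory levels may be given a single value of the
distribution function. -/
theorem exists_monotone_sum_integral_le [IsProbabilityMeasure F]
    (hx : ∀ k, x k ∈ Set.Icc (0 : ℝ) 1) (hmono : Monotone x) :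
    ∃ v : Fin (K + 1) → ℝ, Monotone v ∧ (∀ k, v k ∈ Set.Icc (0 : ℝ) 1) ∧
      ∑ k : Fin (K + 1), ∫ u in breakpoint x k.castSucc..breakpoint x k.succ,
        psi n q k (F.real (Set.Iic u)) ≤
      ∑ k : Fin (K + 1), (breakpoint x k.succ - breakpoint x k.castSucc) * psi n q k (v k) := by
  have hG := monotone_measureReal_Iic F
  have hle := breakpoint_castSucc_le_succ hx hmono
  -- Consecutive ranges share an endpoint, so the chosen maximisers are automatically nondecreasing.
  have hex := fun k : Fin (K + 1) => (isCompact_Icc (a := F.real (Set.Iic (breakpoint x k.castSucc)))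
    (b := F.real (Set.Iic (breakpoint x k.succ)))).exists_isMaxOn
    (Set.nonempty_Icc.2 (hG (hle k))) (continuous_psi n q k).continuousOn
  choose v hv hmax using hex
  refine ⟨v, fun k l hkl => ?_, fun k => ⟨measureReal_nonneg.trans (hv k).1,
    (hv k).2.trans measureReal_le_one⟩, Finset.sum_le_sum fun k _ => ?_⟩
  · rcases hkl.eq_or_lt with rfl | hlt
    · exact le_rfl
    · refine (hv k).2.trans (le_trans (hG (breakpoint_mono hx hmono ?_)) (hv l).1)
      rw [Fin.le_def, Fin.val_succ, Fin.val_castSucc]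
      exact hlt
  · have := intervalIntegral.integral_mono_on (hle k) (intervalIntegrable_psi_cdf (F := F) k _ _)
      (intervalIntegrable_const (c := psi n q k (v k)))
      (fun u hu => hmax k ⟨hG hu.1, hG hu.2⟩)
    rwa [intervalIntegral.integral_const, smul_eq_mul] at this

theorem exists_crossing_index {v : Fin (K + 1) → ℝ} (hv : Monotone v) (q : ℝ) :
    ∃ i ∈ Finset.Icc (-1 : ℤ) K, ∀ k, v k ≤ q ↔ ((k : ℕ) : ℤ) ≤ i := by
  rcases (Finset.univ.filter fun k => v k ≤ q).eq_empty_or_nonempty with h | h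
  · refine ⟨-1, by simp, fun k => ⟨fun hk => ?_, fun hk => by omega⟩⟩
    have : k ∈ Finset.univ.filter fun k => v k ≤ q := by simpa using hk
    simp [h] at this
  · obtain ⟨m, hm, hmax⟩ := Finset.exists_max_image _ id h
    refine ⟨((m : ℕ) : ℤ), by simp; omega, fun k => ⟨fun hk => ?_, fun hk => ?_⟩⟩
    · have := hmax k (by simpa using hk)
      simpa using this
    · have hkm : k ≤ m := by simpa using hk
      exact (hv hkm).trans (Finset.mem_filter.1 hm).2

theorem expectedRegret_le_objective (hn : 1 ≤ ∑ k, n k) (hc : 0 ≤ cu + co)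
    (hq : cu = (cu + co) * q) (hq0 : 0 ≤ q) (hq1 : q ≤ 1) (hx : ∀ k, x k ∈ Set.Icc (0 : ℝ) 1)
    (hmono : Monotone x) (hF : F ∈ demandLaws) :
    ∃ i ∈ Finset.Icc (-1 : ℤ) K, ∃ p : Set.Icc (0 : ℝ) q × Set.Icc q (1 : ℝ),
      expectedRegret cu co (bsaa n q) x F ≤ (cu + co) * objective n q x i p.1 p.2 := by
  have := hF.1
  obtain ⟨v, hv, hv01, hle⟩ := exists_monotone_sum_integral_le (n := n) (q := q) (F := F) hx hmono
  obtain ⟨i, hi, hcross⟩ := exists_crossing_index hv q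
  have hL : ∀ k : Fin (K + 1), 0 ≤ breakpoint x k.succ - breakpoint x k.castSucc := fun k =>
    sub_nonneg.2 (breakpoint_castSucc_le_succ hx hmono k)
  set L : Fin (K + 1) → ℝ := fun k => breakpoint x k.succ - breakpoint x k.castSucc
  -- Pool the two sides of `q` separately, since single crossing is available only within a side. On
  -- an empty side any admissible value serves.
  have h1 : ∃ a ∈ Set.Icc 0 q, ∑ k ∈ Finset.univ.filter (fun k : Fin (K + 1) => ((k : ℕ) : ℤ) ≤ i),
      L k * psi n q k (v k) ≤
      ∑ k ∈ Finset.univ.filter (fun k : Fin (K + 1) => ((k : ℕ) : ℤ) ≤ i), L k * psi n q k a := by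
    rcases (Finset.univ.filter (fun k : Fin (K + 1) => ((k : ℕ) : ℤ) ≤ i)).eq_empty_or_nonempty
      with h | h
    · exact ⟨0, ⟨le_rfl, hq0⟩, by rw [h]; simp⟩
    obtain ⟨j, hj, hs⟩ := exists_sum_le_sum_const _ L hL (psi n q) v hv
      (fun k _ l _ hkl a _ b hb hab => psi_single_crossing n hq0 hq1 hkl (hv01 a).1 hab (hv01 b).2
        (Or.inl ((hcross b).2 (Finset.mem_filter.1 hb).2))) h
    exact ⟨v j, ⟨(hv01 j).1, (hcross j).2 (Finset.mem_filter.1 hj).2⟩, hs⟩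
  have h2 : ∃ b ∈ Set.Icc q 1, ∑ k ∈ Finset.univ.filter (fun k : Fin (K + 1) => i < ((k : ℕ) : ℤ)),
      L k * psi n q k (v k) ≤
      ∑ k ∈ Finset.univ.filter (fun k : Fin (K + 1) => i < ((k : ℕ) : ℤ)), L k * psi n q k b := by
    have hge : ∀ k ∈ Finset.univ.filter (fun k : Fin (K + 1) => i < ((k : ℕ) : ℤ)), q ≤ v k := by
      intro k hk
      by_contra hcon
      exact absurd ((hcross k).1 (not_le.1 hcon).le) (not_le.2 (Finset.mem_filter.1 hk).2)
    rcases (Finset.univ.filter (fun k : Fin (K + 1) => i < ((k : ℕ) : ℤ))).eq_empty_or_nonempty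
      with h | h
    · exact ⟨1, ⟨hq1, le_rfl⟩, by rw [h]; simp⟩
    obtain ⟨j, hj, hs⟩ := exists_sum_le_sum_const _ L hL (psi n q) v hv
      (fun k _ l _ hkl a ha b _ hab => psi_single_crossing n hq0 hq1 hkl (hv01 a).1 hab (hv01 b).2
        (Or.inr (hge a ha))) h
    exact ⟨v j, ⟨hge j hj, (hv01 j).2⟩, hs⟩
  obtain ⟨a, ha, hsa⟩ := h1
  obtain ⟨b, hb, hsb⟩ := h2
  refine ⟨i, hi, (⟨a, ha⟩, ⟨b, hb⟩), ?_⟩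
  rw [expectedRegret_eq hn hc hq hq1 hx hmono hF]
  refine mul_le_mul_of_nonneg_left (hle.trans ?_) hc
  rw [← Finset.sum_filter_add_sum_filter_not Finset.univ
    (fun k : Fin (K + 1) => ((k : ℕ) : ℤ) ≤ i)]
  simp only [not_le]
  exact add_le_add hsa hsb

/-! ### Three-point laws and the lower bound. -/

theorem threePoint_mem_demandLaws {α β y : ℝ} (hα : 0 ≤ α) (hβ : 0 ≤ β) (hαβ : α + β ≤ 1)
    (hy : y ∈ Set.Icc (0 : ℝ) 1) : threePoint α β y ∈ demandLaws := by
  refine ⟨⟨?_⟩, ?_⟩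
  · simp only [threePoint, Measure.add_apply, Measure.smul_apply, measure_univ, smul_eq_mul,
      mul_one]
    rw [← ENNReal.ofReal_add hα hβ, ← ENNReal.ofReal_add (by linarith) (by linarith)]
    simp
  · simp [threePoint, hy.1, hy.2]

theorem threePoint_real_Iic {α β y : ℝ} (hα : 0 ≤ α) (hβ : 0 ≤ β) {u : ℝ} (hu0 : 0 ≤ u)
    (hu1 : u < 1) :
    (threePoint α β y).real (Set.Iic u) = α + if y ≤ u then β else 0 := by
  have h1 : ¬ (1 : ℝ) ≤ u := not_le.2 hu1
  rw [measureReal_def]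
  by_cases h : y ≤ u
  · simp [threePoint, hu0, h1, h, ENNReal.toReal_add, hα, hβ]
  · simp [threePoint, hu0, h1, h, hα]

theorem exists_threePoint_expectedRegret_eq (hn : 1 ≤ ∑ k, n k) (hc : 0 ≤ cu + co)
    (hq : cu = (cu + co) * q) (hq0 : 0 ≤ q) (hq1 : q ≤ 1) (hx : ∀ k, x k ∈ Set.Icc (0 : ℝ) 1)
    (hmono : Monotone x) {i : ℤ} (hi : i ∈ Finset.Icc (-1 : ℤ) K) {v w : ℝ}
    (hv : v ∈ Set.Icc 0 q) (hw : w ∈ Set.Icc q 1) :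
    ∃ (j : Fin K) (α β : ℝ), 0 ≤ α ∧ 0 ≤ β ∧ α + β ≤ 1 ∧ threePoint α β (x j) ∈ demandLaws ∧
      expectedRegret cu co (bsaa n q) x (threePoint α β (x j)) =
        (cu + co) * objective n q x i v w := by
  have hK : 0 < K := by
    rcases Nat.eq_zero_or_pos K with rfl | h
    · simp at hn
    · exact h
  have hu01 : ∀ k : Fin (K + 1), ∀ u ∈ Set.Ico (breakpoint x k.castSucc) (breakpoint x k.succ),
      0 ≤ u ∧ u < 1 := fun k u hu =>
    ⟨(breakpoint_mem hx _).1.trans hu.1, hu.2.trans_le (breakpoint_mem hx _).2⟩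
  rw [Finset.mem_Icc] at hi
  have hw0 : 0 ≤ w := hq0.trans hw.1
  have hv1 : v ≤ 1 := hv.2.trans hq1
  -- For `i = -1` or `i = K` only one of `w`, `v` occurs, so the middle atom has mass zero at an
  -- arbitrary level, which exists since `K > 0`.
  rcases lt_or_ge i 0 with hi0 | hi0
  · have hmem : threePoint w 0 (x ⟨0, hK⟩) ∈ demandLaws :=
      threePoint_mem_demandLaws hw0 le_rfl (by linarith [hw.2]) (hx _)
    refine ⟨⟨0, hK⟩, w, 0, hw0, le_rfl, by linarith [hw.2], hmem,
      expectedRegret_eq_objective hn hc hq hq1 hx hmono hmem i v w fun k u hu => ?_⟩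
    rw [threePoint_real_Iic hw0 le_rfl (hu01 k u hu).1 (hu01 k u hu).2,
      if_neg (show ¬ ((k : ℕ) : ℤ) ≤ i by omega)]
    simp
  lift i to ℕ using hi0
  rcases hi.2.lt_or_eq with hlt | heq
  · have hiK : i < K := by exact_mod_cast hlt
    have hvw : 0 ≤ w - v := sub_nonneg.2 (hv.2.trans hw.1)
    have hmem : threePoint v (w - v) (x ⟨i, hiK⟩) ∈ demandLaws :=
      threePoint_mem_demandLaws hv.1 hvw (by linarith [hw.2]) (hx _)
    -- The jump from `v` to `w` must occur where interval `i` ends; with indexing from `0`, that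
    -- point is `x ⟨i, hiK⟩`.
    refine ⟨⟨i, hiK⟩, v, w - v, hv.1, hvw, by linarith [hw.2], hmem,
      expectedRegret_eq_objective hn hc hq hq1 hx hmono hmem i v w fun k u hu => ?_⟩
    rw [threePoint_real_Iic hv.1 hvw (hu01 k u hu).1 (hu01 k u hu).2]
    have hiff := le_of_breakpoint_le hx hmono hu ⟨i, hiK⟩
    by_cases hk : (k : ℕ) ≤ i
    · rw [if_neg (by rw [hiff]; simpa using hk), if_pos (by exact_mod_cast hk), add_zero]
    · rw [if_pos (by rw [hiff]; simpa using hk), if_neg (by exact_mod_cast hk)]; ring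
  · have hmem : threePoint v 0 (x ⟨0, hK⟩) ∈ demandLaws :=
      threePoint_mem_demandLaws hv.1 le_rfl (by linarith) (hx _)
    refine ⟨⟨0, hK⟩, v, 0, hv.1, le_rfl, by linarith, hmem,
      expectedRegret_eq_objective hn hc hq hq1 hx hmono hmem i v w fun k u hu => ?_⟩
    rw [threePoint_real_Iic hv.1 le_rfl (hu01 k u hu).1 (hu01 k u hu).2,
      if_pos (show ((k : ℕ) : ℤ) ≤ (i : ℤ) by omega)]
    simp

end

end Newsvendor

/-! ### The worst-case regret formula and its attainment. -/

theorem theorem2 {K : ℕ} (n : Fin K → ℕ) (hn : 1 ≤ ∑ k, n k)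
    (cu co : ℝ) (hcu : 0 < cu) (hco : 0 < co)
    (q : ℝ) (hq : q = cu / (cu + co))
    (x : Fin K → ℝ) (hx : ∀ k, x k ∈ Set.Icc (0 : ℝ) 1) (hmono : Monotone x) :
    -- the expectations and suprema below are genuine
    (∀ F ∈ Newsvendor.demandLaws,
      MeasureTheory.Integrable
        (fun D : Newsvendor.Sample n → ℝ =>
          Newsvendor.regret cu co (Newsvendor.bsaa n q x (Newsvendor.censor x D)) F)
        (MeasureTheory.Measure.pi fun _ : Newsvendor.Sample n => F)) ∧
    BddAbove ((fun F => Newsvendor.expectedRegret cu co (Newsvendor.bsaa n q) x F) ''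
      Newsvendor.demandLaws) ∧
    (∀ i ∈ Finset.Icc (-1 : ℤ) K,
      BddAbove (Set.range fun p : Set.Icc (0 : ℝ) q × Set.Icc q (1 : ℝ) =>
        Newsvendor.objective n q x i p.1 p.2)) ∧
    -- the worst-case regret as a finite maximum of two-scalar suprema
    Newsvendor.worstCaseRegret cu co (Newsvendor.bsaa n q) x =
      (cu + co) *
        (Finset.Icc (-1 : ℤ) K).sup' (Finset.nonempty_Icc.2 (by omega)) (fun i =>
          ⨆ p : Set.Icc (0 : ℝ) q × Set.Icc q (1 : ℝ),
            Newsvendor.objective n q x i p.1 p.2) ∧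
    -- the worst case is attained at a distribution on `0`, a historical inventory level, and `1`
    (∃ (j : Fin K) (α β : ℝ), 0 ≤ α ∧ 0 ≤ β ∧ α + β ≤ 1 ∧
      Newsvendor.threePoint α β (x j) ∈ Newsvendor.demandLaws ∧
      Newsvendor.expectedRegret cu co (Newsvendor.bsaa n q) x
          (Newsvendor.threePoint α β (x j)) =
        Newsvendor.worstCaseRegret cu co (Newsvendor.bsaa n q) x) := by
  have hc : 0 < cu + co := by linarith
  have hqc : cu = (cu + co) * q := by rw [hq]; field_simp
  have hq0 : 0 ≤ q := by rw [hq]; positivity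
  have hq1 : q ≤ 1 := by rw [hq, div_le_one hc]; linarith
  have hne1 : Nonempty (Set.Icc (0 : ℝ) q) := ⟨⟨0, le_rfl, hq0⟩⟩
  have hne2 : Nonempty (Set.Icc q (1 : ℝ)) := ⟨⟨1, hq1, le_rfl⟩⟩
  have hcont := fun i : ℤ => Newsvendor.continuous_objective (n := n) (q := q) (x := x) i
  have hbdd : ∀ i : ℤ, BddAbove (Set.range fun p : Set.Icc (0 : ℝ) q × Set.Icc q (1 : ℝ) =>
      Newsvendor.objective n q x i p.1 p.2) := fun i => (isCompact_range (hcont i)).bddAbove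
  set M := (Finset.Icc (-1 : ℤ) K).sup' (Finset.nonempty_Icc.2 (by omega)) (fun i =>
    ⨆ p : Set.Icc (0 : ℝ) q × Set.Icc q (1 : ℝ), Newsvendor.objective n q x i p.1 p.2) with hM
  have hupper : ∀ F ∈ Newsvendor.demandLaws,
      Newsvendor.expectedRegret cu co (Newsvendor.bsaa n q) x F ≤ (cu + co) * M := by
    intro F hF
    obtain ⟨i, hi, p, hp⟩ :=
      Newsvendor.expectedRegret_le_objective hn hc.le hqc hq0 hq1 hx hmono hF
    refine hp.trans (mul_le_mul_of_nonneg_left ((le_ciSup (hbdd i) p).trans ?_) hc.le)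
    exact Finset.le_sup' (fun i => ⨆ p : Set.Icc (0 : ℝ) q × Set.Icc q (1 : ℝ),
      Newsvendor.objective n q x i p.1 p.2) hi
  -- A finite maximum of suprema of continuous functions on a compact rectangle is attained; the
  -- optimal triple yields the extremal law.
  have hattained : ∃ i ∈ Finset.Icc (-1 : ℤ) K, ∃ p : Set.Icc (0 : ℝ) q × Set.Icc q (1 : ℝ),
      M = Newsvendor.objective n q x i p.1 p.2 := by
    obtain ⟨i, hi, hMi⟩ := Finset.exists_mem_eq_sup' (s := Finset.Icc (-1 : ℤ) K)
      (Finset.nonempty_Icc.2 (by omega)) (fun i =>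
        ⨆ p : Set.Icc (0 : ℝ) q × Set.Icc q (1 : ℝ), Newsvendor.objective n q x i p.1 p.2)
    obtain ⟨p, -, hp⟩ := isCompact_univ.exists_isMaxOn Set.univ_nonempty (hcont i).continuousOn
    exact ⟨i, hi, p, hM.trans (hMi.trans (le_antisymm
      (ciSup_le fun p' => hp (Set.mem_univ p')) (le_ciSup (hbdd i) p)))⟩
  obtain ⟨i, hi, p, hp⟩ := hattained
  obtain ⟨j, α, β, hα, hβ, hαβ, hmem, hval⟩ :=
    Newsvendor.exists_threePoint_expectedRegret_eq hn hc.le hqc hq0 hq1 hx hmono hi p.1.2 p.2.2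
  rw [← hp] at hval
  have hbound : BddAbove ((fun F => Newsvendor.expectedRegret cu co (Newsvendor.bsaa n q) x F) ''
      Newsvendor.demandLaws) := ⟨(cu + co) * M, by rintro _ ⟨F, hF, rfl⟩; exact hupper F hF⟩
  have hworst : Newsvendor.worstCaseRegret cu co (Newsvendor.bsaa n q) x = (cu + co) * M := by
    refine IsGreatest.csSup_eq ⟨⟨_, hmem, hval⟩, ?_⟩
    rintro _ ⟨F, hF, rfl⟩
    exact hupper F hF
  exact ⟨fun F hF => Newsvendor.integrable_regret_bsaa hn hc.le hqc hq1 hx hF, hbound,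
    fun i _ => hbdd i, hworst, j, α, β, hα, hβ, hαβ, hmem, hval.trans hworst.symm⟩
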